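/- Let $N\ge 1$, $Q=(0,1)^N$, and let $r>0$, written as $r=k+s$ with $k=\lfloor r\rfloor$ and $s\in[0,1)$. Definitions. For $0<s<1$ and a smooth compactly supported function $f$ on $Q$, let $\partial_{i,R}^s f$ be the right-sided Riemann--Liouville derivative in the variable $x_i$, i.e. on each line parallel to the $x_i$-axis the operator $$d_R^s w(x)=-\frac1{\Gamma(1-s)}\frac{d}{dx}\int_x^1\frac{w(t)}{(t-x)^s}\,dt ,\qquad x\in(0,1),$$ and for a vector field $F=(F_1,\dots,F_N)$ put $\operatorname{div}^sF=\big[(1-\tfrac1N)s+\tfrac1N\big]\sum_{i=1}^N\partial^s_{i,R}F_i$. For a field of tensors of order $k$ put $\operatorname{div}^k\varphi=\sum_{j_1,\dots,j_k}\partial_{j_1}\cdots\partial_{j_k}\varphi_{j_1\dots j_k}$; for an array $\varphi=(\varphi_{i,j_1\dots j_k})$ the divergence $\operatorname{div}^k$ acts on the indices $j_1,\dots,j_k$ and gives a vector field. For $p\in[1,\infty]$ let $|\cdot|_{\ell^p}^*$ be the norm dual to the $\ell^p$ norm (all entries of an array are counted as coordinates). For $u\in L^1(Q)$ the total variation of order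 $r=k+s\ge 0$ is $$TV^{r}_{\ell^p}(u)=\sup\Big\{\int_Q u\,\operatorname{div}^s[\operatorname{div}^k\varphi]\,dx:\ \varphi\in C_c^\infty(Q;\mathbb R^{N\times N^k}),\ |\varphi|^*_{\ell^p}\le 1\Big\}\in[0,\infty]\qquad\text{if } 0<s<1,$$ $$TV^{k}_{\ell^p}(u)=\sup\Big\{\int_Q u\,\operatorname{div}^k\varphi\,dx:\ \varphi\in C_c^\infty(Q;\mathbb R^{N^k}),\ |\varphi|^*_{\ell^p}\le 1\Big\}\in[0,\infty]\qquad\text{if } s=0,$$ so that $TV^0_{\ell^p}(u)=\|u\|_{L^1(Q)}$. Let $SV^r(Q)$ be the set of all $u\in L^1(Q)$ such that for every $p\in[1,\infty]$ one has $TV^r_{\ell^p}(u)<\infty$ and there is a sequence $(u_n)\subset C^\infty(Q)\cap L^1(Q)$ with $TV^r_{\ell^p}(u_n)<\infty$ for all $n$, $u_n\to u$ in $L^1(Q)$ and $TV^r_{\ell^p}(u_n)\to TV^r_{\ell^p}(u)$. Theorem. There is a constant $C_r>0$, depending only on $r$ and $N$, such that for every $p\in[1,\infty]$ and every $u\in SV^r(Q)$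 $$TV^{s}_{\ell^p}(u)\le C_r\big(\|u\|_{L^1(Q)}+TV^r_{\ell^p}(u)\big).$$ -/

import Mathlib

open MeasureTheory Filter Topology
open scoped ENNReal ContDiff

noncomputable section

namespace FracTV

/-- The open unit cube `(0,1)^N`. -/
def cube (N : ℕ) : Set (Fin N → ℝ) := Set.univ.pi fun _ => Set.Ioo (0 : ℝ) 1

/-- The right-sided Riemann-Liouville derivative of order `s ∈ [0,1)` on the unit interval,
`-(1/Γ(1-s)) d/dx ∫_x^1 w(t) (t-x)^{-s} dt`. -/
def rightRL (s : ℝ) (w : ℝ → ℝ) (x : ℝ) : ℝ :=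
  -(1 / Real.Gamma (1 - s)) * deriv (fun y => ∫ t in y..1, w t / (t - y) ^ s) x

/-- The right-sided partial derivative of order `s` in the `i`-th variable. -/
def partialRL {N : ℕ} (s : ℝ) (i : Fin N) (f : (Fin N → ℝ) → ℝ) (x : Fin N → ℝ) : ℝ :=
  rightRL s (fun t => f (Function.update x i t)) (x i)

/-- The `k`-fold divergence of a field of tensors of order `k`; each step contracts the last
index, so the result is `∑_{j₁,…,j_k} ∂_{j₁} ⋯ ∂_{j_k} φ_{j₁ … j_k}`. -/
def iterDiv {N : ℕ} : (k : ℕ) → ((Fin k → Fin N) → (Fin N → ℝ) → ℝ) → (Fin N → ℝ) → ℝ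
  | 0, φ => φ fun i => i.elim0
  | k + 1, φ => iterDiv k fun a x =>
      ∑ j : Fin N, fderiv ℝ (φ (Fin.snoc (α := fun _ => Fin N) a j)) x (Pi.single j 1)

/-- The fractional divergence of order `s` of a vector field, with its normalizing factor. -/
def fracDiv {N : ℕ} (s : ℝ) (F : Fin N → (Fin N → ℝ) → ℝ) (x : Fin N → ℝ) : ℝ :=
  ((1 - 1 / (N : ℝ)) * s + 1 / (N : ℝ)) * ∑ i : Fin N, partialRL s i (F i) x

/-- The norm dual to the `ℓ^p` norm on `ℝ^ι`. -/
def dualNorm {ι : Type} [Fintype ι] (p : ℝ≥0∞) (a : ι → ℝ) : ℝ :=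
  sSup {t : ℝ | ∃ y : PiLp p (fun _ : ι => ℝ), ‖y‖ ≤ 1 ∧ t = ∑ i, a i * y i}

/-- Fields `φ ∈ C_c^∞(Q; ℝ^ι)` with `|φ|^*_{ℓ^p} ≤ 1` everywhere. -/
def IsTest {N : ℕ} {ι : Type} [Fintype ι] (p : ℝ≥0∞) (φ : ι → (Fin N → ℝ) → ℝ) : Prop :=
  (∀ i, ContDiff ℝ ∞ (φ i) ∧ HasCompactSupport (φ i) ∧ tsupport (φ i) ⊆ cube N) ∧
    ∀ x, dualNorm p (fun i => φ i x) ≤ 1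

/-- Total variation of integer order `k`. For `k = 0` the field `φ` is scalar and the value is
the `L^1` norm. The zero field is admissible, so the supremum is that of the real numbers
`∫_Q u div^k φ`. -/
def intTV {N : ℕ} (p : ℝ≥0∞) (k : ℕ) (u : (Fin N → ℝ) → ℝ) : ℝ≥0∞ :=
  ⨆ (φ : (Fin k → Fin N) → (Fin N → ℝ) → ℝ) (_ : IsTest p φ),
    ENNReal.ofReal (∫ x in cube N, u x * iterDiv k φ x)

/-- Total variation of order `k + s`, `0 < s < 1`; the field takes values in `N × N^k` arrays. -/
def fracTV {N : ℕ} (p : ℝ≥0∞) (k : ℕ) (s : ℝ) (u : (Fin N → ℝ) → ℝ) : ℝ≥0∞ :=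
  ⨆ (φ : Fin N × (Fin k → Fin N) → (Fin N → ℝ) → ℝ) (_ : IsTest p φ),
    ENNReal.ofReal
      (∫ x in cube N, u x * fracDiv s (fun i => iterDiv k fun a => φ (i, a)) x)

open Classical in
/-- The total variation of order `r ≥ 0` with underlying `ℓ^p` norm. -/
def TV {N : ℕ} (p : ℝ≥0∞) (r : ℝ) (u : (Fin N → ℝ) → ℝ) : ℝ≥0∞ :=
  if Int.fract r = 0 then intTV p ⌊r⌋₊ u else fracTV p ⌊r⌋₊ (Int.fract r) u

/-- The norm of `L^1(Q)`. -/
def normL1 {N : ℕ} (u : (Fin N → ℝ) → ℝ) : ℝ≥0∞ := ∫⁻ x in cube N, ‖u x‖ₑ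

/-- Strict convergence `v n → u` with respect to the total variation of order `r` with
underlying `ℓ^p` norm. All the total variations involved are finite. -/
structure StrictConv {N : ℕ} (p : ℝ≥0∞) (r : ℝ) (v : ℕ → (Fin N → ℝ) → ℝ)
    (u : (Fin N → ℝ) → ℝ) : Prop where
  integrable_seq : ∀ n, IntegrableOn (v n) (cube N)
  finite_seq : ∀ n, TV p r (v n) < ⊤
  integrable_lim : IntegrableOn u (cube N)
  finite_lim : TV p r u < ⊤
  tendsto_L1 : Tendsto (fun n => normL1 (fun x => u x - v n x)) atTop (𝓝 0)
  tendsto_TV : Tendsto (fun n => TV p r (v n)) atTop (𝓝 (TV p r u))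

/-- The space `SV^r(Q)`: functions which for every `p ∈ [1,∞]` are strict limits of functions
that are smooth in the open cube. -/
def SV (N : ℕ) (r : ℝ) : Set ((Fin N → ℝ) → ℝ) :=
  {u | ∀ p : ℝ≥0∞, 1 ≤ p → ∃ v : ℕ → (Fin N → ℝ) → ℝ,
    (∀ n, ContDiffOn ℝ ∞ (v n) (cube N)) ∧ StrictConv p r v u}

end FracTV

end

/-!
A test function `f` on the cube with `|f| ≤ 1` can be split as `f = ∂_i^k g + R`, where `g` and
`∂_i R` are bounded by a constant depending only on `k`. One derivative is gained at a time:
subtract from `g` the product of its integrals over the lines parallel to the `i`-th axis with a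
profile `η(x_i)` of integral `1`. The difference has zero integral over these lines, so it is `∂_i`
of a bounded test function, while `∂_i`-derivatives of the product fall on the fixed `η` only.

Split each component of a field `φ` which is admissible for `TV^s` in this way. The main part is
`div^k` of the array with entries `g_i` at the positions `(i, i … i)`, which is admissible for
`TV^r` up to a constant factor. The fractional derivative of `R_i` is a fractional integral of
`∂_i R_i`, hence bounded, so that the remainder contributes at most a multiple of the `L^1` norm of
`u`.
-/

namespace FracTV

section TestFunctions

variable {E : Type*} [NormedAddCommGroup E] [NormedSpace ℝ E] {Ω : Set E} {f g : E → ℝ}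

/-- The space `C_c^∞(Ω)` of test functions, as a predicate. -/
structure IsTestFun (Ω : Set E) (f : E → ℝ) : Prop where
  contDiff : ContDiff ℝ ∞ f
  hasCompactSupport : HasCompactSupport f
  tsupport_subset : tsupport f ⊆ Ω

/-- The derivative in the direction `v`, as an operator on functions which can be iterated. -/
noncomputable def dirDeriv (v : E) (f : E → ℝ) (x : E) : ℝ := fderiv ℝ f x v

theorem dirDeriv_add (hf : Differentiable ℝ f) (hg : Differentiable ℝ g) (v : E) :
    dirDeriv v (f + g) = dirDeriv v f + dirDeriv v g := by
  ext x
  simp only [dirDeriv, fderiv_add (hf x) (hg x), add_apply, Pi.add_apply]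

theorem hasDerivAt_comp_line (hf : Differentiable ℝ f) (x v : E) (t : ℝ) :
    HasDerivAt (fun t : ℝ => f (x + t • v)) (dirDeriv v f (x + t • v)) t := by
  have hline : HasDerivAt (fun t : ℝ => x + t • v) v t := by
    simpa using ((hasDerivAt_id t).smul_const v).const_add x
  exact (hf _).hasFDerivAt.comp_hasDerivAt t hline

theorem dirDeriv_eq_of_hasDerivAt (hf : Differentiable ℝ f) {x v : E} {d : ℝ}
    (h : HasDerivAt (fun t : ℝ => f (x + t • v)) d 0) : dirDeriv v f x = d := by
  simpa using (hasDerivAt_comp_line hf x v 0).unique h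

namespace IsTestFun

theorem of_support_subset {K : Set E} (hf : ContDiff ℝ ∞ f) (hK : IsCompact K)
    (hfK : Function.support f ⊆ K) (hKΩ : K ⊆ Ω) : IsTestFun Ω f :=
  ⟨hf, .of_support_subset_isCompact hK hfK, (closure_minimal hfK hK.isClosed).trans hKΩ⟩

theorem zero : IsTestFun Ω (0 : E → ℝ) :=
  of_support_subset contDiff_const isCompact_empty (by simp) (Set.empty_subset Ω)

theorem continuous (hf : IsTestFun Ω f) : Continuous f := hf.contDiff.continuous

theorem differentiable (hf : IsTestFun Ω f) : Differentiable ℝ f :=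
  hf.contDiff.differentiable (by simp)

theorem eq_zero (hf : IsTestFun Ω f) {x : E} (hx : x ∉ Ω) : f x = 0 :=
  image_eq_zero_of_notMem_tsupport fun h => hx (hf.tsupport_subset h)

theorem add (hf : IsTestFun Ω f) (hg : IsTestFun Ω g) : IsTestFun Ω (f + g) :=
  ⟨hf.contDiff.add hg.contDiff, hf.hasCompactSupport.add hg.hasCompactSupport,
    (tsupport_add f g).trans (Set.union_subset hf.tsupport_subset hg.tsupport_subset)⟩

theorem const_smul (hf : IsTestFun Ω f) (c : ℝ) : IsTestFun Ω (c • f) :=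
  ⟨hf.contDiff.const_smul c, hf.hasCompactSupport.smul_left (f := fun _ => c),
    (tsupport_smul_subset_right (fun _ => c) f).trans hf.tsupport_subset⟩

theorem sub (hf : IsTestFun Ω f) (hg : IsTestFun Ω g) : IsTestFun Ω (f - g) := by
  simpa [sub_eq_add_neg] using hf.add (hg.const_smul (-1))

protected theorem dirDeriv (hf : IsTestFun Ω f) (v : E) : IsTestFun Ω (dirDeriv v f) :=
  ⟨(hf.contDiff.fderiv_right (m := ∞) (by simp)).clm_apply contDiff_const,
    hf.hasCompactSupport.fderiv_apply ℝ v,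
    (tsupport_fderiv_apply_subset ℝ v).trans hf.tsupport_subset⟩

theorem iterate_dirDeriv (hf : IsTestFun Ω f) (v : E) (k : ℕ) :
    IsTestFun Ω ((dirDeriv v)^[k] f) := by
  induction k with
  | zero => exact hf
  | succ k ih => rw [Function.iterate_succ_apply']; exact ih.dirDeriv v

theorem exists_bound (hf : IsTestFun Ω f) : ∃ M, 0 ≤ M ∧ ∀ x, |f x| ≤ M := by
  obtain ⟨M, hM⟩ := hf.hasCompactSupport.exists_bound_of_continuous hf.continuous
  exact ⟨M, (norm_nonneg _).trans (hM 0), hM⟩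

theorem comp_line (hf : IsTestFun Ω f) {v : E} (hv : v ≠ 0) (x : E) :
    IsTestFun {t : ℝ | x + t • v ∈ Ω} fun t : ℝ => f (x + t • v) := by
  have hline : IsClosedEmbedding fun t : ℝ => x + t • v :=
    (Homeomorph.addLeft x).isClosedEmbedding.comp (isClosedEmbedding_smul_left hv)
  refine ⟨hf.contDiff.comp (by fun_prop), hf.hasCompactSupport.comp_isClosedEmbedding hline, ?_⟩
  exact (tsupport_comp_subset_preimage f hline.continuous).trans
    (Set.preimage_mono hf.tsupport_subset)

end IsTestFun

theorem iterate_dirDeriv_add (hf : IsTestFun Ω f) (hg : IsTestFun Ω g) (v : E) (k : ℕ) :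
    (dirDeriv v)^[k] (f + g) = (dirDeriv v)^[k] f + (dirDeriv v)^[k] g := by
  induction k with
  | zero => rfl
  | succ k ih =>
    simp only [Function.iterate_succ_apply', ih]
    exact dirDeriv_add (hf.iterate_dirDeriv v k).differentiable
      (hg.iterate_dirDeriv v k).differentiable v

end TestFunctions

section LineIntegrals

variable {E : Type*} [NormedAddCommGroup E] [NormedSpace ℝ E] {Ω : Set E} {f : E → ℝ} {v : E}

/-- The integral of `f` over the line through `x` with direction `v`. -/
noncomputable def lineIntegral (v : E) (f : E → ℝ) (x : E) : ℝ := ∫ t : ℝ, f (x + t • v)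

/-- The primitive of `f` in the direction `v` which vanishes at `-∞` on each line. -/
noncomputable def primitive (v : E) (f : E → ℝ) (x : E) : ℝ := ∫ t in Set.Iic (0 : ℝ), f (x + t • v)

theorem IsTestFun.integrable_line (hf : IsTestFun Ω f) (hv : v ≠ 0) (x : E) :
    Integrable fun t : ℝ => f (x + t • v) :=
  (hf.comp_line hv x).continuous.integrable_of_hasCompactSupport
    (hf.comp_line hv x).hasCompactSupport

theorem lineIntegral_add_smul (v : E) (f : E → ℝ) (x : E) (τ : ℝ) :
    lineIntegral v f (x + τ • v) = lineIntegral v f x := by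
  simp only [lineIntegral, add_assoc, ← add_smul]
  exact integral_add_left_eq_self (fun t => f (x + t • v)) τ

theorem lineIntegral_sub {g : E → ℝ} (hf : IsTestFun Ω f) (hg : IsTestFun Ω g) (hv : v ≠ 0) :
    lineIntegral v (f - g) = lineIntegral v f - lineIntegral v g :=
  funext fun x => integral_sub (hf.integrable_line hv x) (hg.integrable_line hv x)

theorem IsTestFun.contDiff_setIntegral_line (hf : IsTestFun Ω f) (hv : v ≠ 0) {S : Set ℝ}
    (hS : MeasurableSet S) : ContDiff ℝ ∞ fun x => ∫ t in S, f (x + t • v) := by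
  -- Near `x₀` only a bounded range of `t` matters, so that the integral is locally the convolution
  -- at `0` of the indicator of `-S` with a function which depends smoothly on the parameter `x`.
  refine contDiff_iff_contDiffAt.2 fun x₀ => ?_
  obtain ⟨R, hR⟩ := hf.hasCompactSupport.isCompact.isBounded.exists_norm_le
  have hout : ∀ x t, x ∈ Metric.ball x₀ 1 →
      t ∉ Metric.closedBall (0 : ℝ) ((R + ‖x₀‖ + 1) / ‖v‖) → f (x + t • v) = 0 := by
    intro x t hx ht
    refine image_eq_zero_of_notMem_tsupport fun hmem => ht ?_
    rw [mem_closedBall_zero_iff, le_div_iff₀ (norm_pos_iff.2 hv), ← norm_smul]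
    have hdist : ‖x - x₀‖ < 1 := mem_ball_iff_norm.1 hx
    calc ‖t • v‖ = ‖(x + t • v) - x₀ - (x - x₀)‖ := by congr 1; abel
      _ ≤ ‖x + t • v‖ + ‖x₀‖ + ‖x - x₀‖ :=
        (norm_sub_le _ _).trans (add_le_add_left (norm_sub_le _ _) _)
      _ ≤ R + ‖x₀‖ + 1 := by gcongr; exact hR _ hmem
  have hconv := contDiffOn_convolution_right_with_param_comp (μ := volume) (n := ⊤)
    (ContinuousLinearMap.mul ℝ ℝ) (g := fun x t => f (x + t • v)) (v := fun _ => (0 : ℝ))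
    (f := (-S).indicator 1) contDiffOn_const Metric.isOpen_ball (isCompact_closedBall 0 _) hout
    ((locallyIntegrable_const (1 : ℝ)).indicator hS.neg)
    (hf.contDiff.comp (by fun_prop)).contDiffOn
  refine (hconv.contDiffAt (Metric.ball_mem_nhds x₀ one_pos)).congr_of_eventuallyEq
    (.of_forall fun x => ?_)
  simp only [convolution]
  rw [← integral_indicator hS, ← integral_neg_eq_self]
  refine integral_congr_ae (.of_forall fun t => ?_)
  by_cases ht : -t ∈ S <;> simp [Set.indicator, ht]

theorem IsTestFun.contDiff_lineIntegral (hf : IsTestFun Ω f) (hv : v ≠ 0) :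
    ContDiff ℝ ∞ (lineIntegral v f) := by
  have h := hf.contDiff_setIntegral_line hv .univ
  simp only [setIntegral_univ] at h
  exact h

theorem IsTestFun.contDiff_primitive (hf : IsTestFun Ω f) (hv : v ≠ 0) :
    ContDiff ℝ ∞ (primitive v f) :=
  hf.contDiff_setIntegral_line hv measurableSet_Iic

theorem primitive_add_smul (v : E) (f : E → ℝ) (x : E) (τ : ℝ) :
    primitive v f (x + τ • v) = ∫ t in Set.Iic τ, f (x + t • v) := by
  have hshift := (measurePreserving_add_left volume τ).setIntegral_preimage_emb
    (measurableEmbedding_addLeft τ) (fun t => f (x + t • v)) (Set.Iic τ)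
  simpa [primitive, add_assoc, ← add_smul] using hshift

theorem IsTestFun.dirDeriv_primitive (hf : IsTestFun Ω f) (hv : v ≠ 0) :
    dirDeriv v (primitive v f) = f := by
  ext x
  refine dirDeriv_eq_of_hasDerivAt ((hf.contDiff_primitive hv).differentiable (by simp)) ?_
  have hint := hf.integrable_line hv x
  have hderiv : HasDerivAt (fun τ : ℝ => primitive v f x + ∫ t in (0 : ℝ)..τ, f (x + t • v))
      (f x) 0 := by
    simpa using ((hf.comp_line hv x).continuous.integral_hasStrictDerivAt 0 0).hasDerivAt.const_add
      (primitive v f x)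
  convert hderiv using 2 with τ
  rw [primitive_add_smul, ← intervalIntegral.integral_Iic_sub_Iic hint.integrableOn
    hint.integrableOn, primitive, add_sub_cancel]

theorem exists_support_of_primitive_ne_zero {x : E} (h0 : lineIntegral v f x = 0)
    (hx : primitive v f x ≠ 0) :
    ∃ a ≤ (0 : ℝ), ∃ b ≥ (0 : ℝ), f (x + a • v) ≠ 0 ∧ f (x + b • v) ≠ 0 := by
  by_contra! hcon
  refine hx ?_
  by_cases hleft : ∃ a ≤ (0 : ℝ), f (x + a • v) ≠ 0
  · obtain ⟨a, ha, hfa⟩ := hleft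
    rw [← h0]
    exact setIntegral_eq_integral_of_forall_compl_eq_zero fun b hb =>
      hcon a ha b (not_le.1 hb).le hfa
  · push Not at hleft
    exact setIntegral_eq_zero_of_forall_eq_zero hleft

protected theorem IsTestFun.primitive (hf : IsTestFun Ω f) (hΩ : Convex ℝ Ω) (hv : v ≠ 0)
    (h0 : lineIntegral v f = 0) : IsTestFun Ω (primitive v f) := by
  have hK := hf.hasCompactSupport.isCompact
  refine of_support_subset (hf.contDiff_primitive hv)
    (((hK.prod hK).prod (isCompact_Icc (a := (0 : ℝ)) (b := 1))).image
      (f := fun q => AffineMap.lineMap q.1.1 q.1.2 q.2) ?_) (fun x hx => ?_) ?_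
  · simp only [AffineMap.lineMap_apply_module]
    fun_prop
  · obtain ⟨a, ha, b, hb, hfa, hfb⟩ := exists_support_of_primitive_ne_zero (congrFun h0 x) hx
    have hmem : (0 : ℝ) ∈ segment ℝ a b := by
      rw [segment_eq_Icc (ha.trans hb)]; exact ⟨ha, hb⟩
    rw [segment_eq_image_lineMap] at hmem
    obtain ⟨θ, hθ, hθ0⟩ := hmem
    refine ⟨((x + a • v, x + b • v), θ),
      ⟨⟨subset_tsupport f hfa, subset_tsupport f hfb⟩, hθ⟩, ?_⟩
    calc AffineMap.lineMap (x + a • v) (x + b • v) θ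
        = x + (AffineMap.lineMap a b θ : ℝ) • v := by
          simp only [AffineMap.lineMap_apply_module, smul_eq_mul]; module
      _ = x := by rw [hθ0, zero_smul, add_zero]
  · rintro _ ⟨⟨⟨y, z⟩, θ⟩, ⟨⟨hy, hz⟩, hθ⟩, rfl⟩
    exact hΩ.lineMap_mem (hf.tsupport_subset hy) (hf.tsupport_subset hz) hθ

end LineIntegrals

section Redistribution

variable {E : Type*} [NormedAddCommGroup E] [NormedSpace ℝ E] {Ω : Set E} {f : E → ℝ} {v : E}
  {ℓ : E →L[ℝ] ℝ} {η : ℝ → ℝ}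

/-- The function obtained from `f` by concentrating its integral over each line of direction `v`
according to the profile `η` in the coordinate `ℓ` of that line. It has the same line integrals as
`f` if `ℓ v = 1` and `η` has integral `1`. -/
noncomputable def redistribute (v : E) (ℓ : E →L[ℝ] ℝ) (η : ℝ → ℝ) (f : E → ℝ) (x : E) : ℝ :=
  lineIntegral v f x * η (ℓ x)

theorem ne_zero_of_apply_eq_one (hℓ : ℓ v = 1) : v ≠ 0 := by
  rintro rfl
  simp at hℓ

theorem IsTestFun.contDiff_redistribute (hf : IsTestFun Ω f) (hv : v ≠ 0) (hη : ContDiff ℝ ∞ η) :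
    ContDiff ℝ ∞ (redistribute v ℓ η f) :=
  (hf.contDiff_lineIntegral hv).mul (hη.comp ℓ.contDiff)

theorem lineIntegral_redistribute (hℓ : ℓ v = 1) (η : ℝ → ℝ) (f : E → ℝ) :
    lineIntegral v (redistribute v ℓ η f) = (∫ t, η t) • lineIntegral v f := by
  ext x
  calc lineIntegral v (redistribute v ℓ η f) x
      = ∫ t : ℝ, lineIntegral v f x * η (ℓ x + t) := by
        rw [lineIntegral]
        simp only [redistribute, lineIntegral_add_smul, map_add, map_smul, hℓ, smul_eq_mul, mul_one]
    _ = lineIntegral v f x * ∫ t, η t := by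
        rw [integral_const_mul, integral_add_left_eq_self]
    _ = ((∫ t, η t) • lineIntegral v f) x := mul_comm _ _

theorem IsTestFun.dirDeriv_redistribute (hf : IsTestFun Ω f) (hℓ : ℓ v = 1)
    (hη : ContDiff ℝ ∞ η) :
    dirDeriv v (redistribute v ℓ η f) = redistribute v ℓ (dirDeriv 1 η) f := by
  ext x
  refine dirDeriv_eq_of_hasDerivAt
    ((hf.contDiff_redistribute (ne_zero_of_apply_eq_one hℓ) hη).differentiable (by simp)) ?_
  have hline : HasDerivAt (fun t : ℝ => η (ℓ x + t • 1)) (dirDeriv 1 η (ℓ x)) 0 := by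
    simpa using hasDerivAt_comp_line (hη.differentiable (by simp)) (ℓ x) 1 0
  simpa [redistribute, lineIntegral_add_smul, hℓ] using hline.const_mul (lineIntegral v f x)

theorem IsTestFun.iterate_dirDeriv_redistribute {J : Set ℝ} (hf : IsTestFun Ω f) (hℓ : ℓ v = 1)
    (hη : IsTestFun J η) (k : ℕ) :
    (dirDeriv v)^[k] (redistribute v ℓ η f) =
      redistribute v ℓ ((dirDeriv 1)^[k] η) f := by
  induction k with
  | zero => rfl
  | succ k ih =>
    simp only [Function.iterate_succ_apply', ih]
    exact hf.dirDeriv_redistribute hℓ (hη.iterate_dirDeriv 1 k).contDiff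

end Redistribution

section Cube

variable {N : ℕ} {f : (Fin N → ℝ) → ℝ} {η : ℝ → ℝ}

theorem convex_cube : Convex ℝ (cube N) := convex_pi fun _ _ => convex_Ioo 0 1

theorem measurableSet_cube : MeasurableSet (cube N) :=
  .univ_pi fun _ => measurableSet_Ioo

theorem single_one_ne_zero (i : Fin N) : (Pi.single i 1 : Fin N → ℝ) ≠ 0 := by simp

theorem abs_setIntegral_line_le {M : ℝ} (hf : ∀ x ∉ cube N, f x = 0) (hM : ∀ x, |f x| ≤ M)
    (i : Fin N) (x : Fin N → ℝ) (S : Set ℝ) : |∫ t in S, f (x + t • Pi.single i 1)| ≤ M := by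
  have hout : ∀ t ∉ Set.Ioo (-x i) (1 - x i), f (x + t • Pi.single i 1) = 0 := by
    refine fun t ht => hf _ fun hmem => ht ?_
    have hi : x i + t ∈ Set.Ioo (0 : ℝ) 1 := by simpa using hmem i trivial
    exact ⟨by linarith [hi.1], by linarith [hi.2]⟩
  have hvol : (volume.restrict S).real (Set.Ioo (-x i) (1 - x i)) ≤ 1 := by
    refine (ENNReal.toReal_mono measure_Ioo_lt_top.ne (Measure.restrict_apply_le _ _)).trans_eq ?_
    simp
  rw [← setIntegral_eq_integral_of_forall_compl_eq_zero hout]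
  calc |∫ t in Set.Ioo (-x i) (1 - x i), f (x + t • Pi.single i 1) ∂volume.restrict S|
      ≤ M * (volume.restrict S).real (Set.Ioo (-x i) (1 - x i)) := by
        rw [← Real.norm_eq_abs]
        exact norm_setIntegral_le_of_norm_le_const
          ((Measure.restrict_apply_le _ _).trans_lt measure_Ioo_lt_top) fun t _ => hM _
    _ ≤ M := mul_le_of_le_one_right ((abs_nonneg _).trans (hM 0)) hvol

theorem abs_lineIntegral_le {M : ℝ} (hf : ∀ x ∉ cube N, f x = 0) (hM : ∀ x, |f x| ≤ M)
    (i : Fin N) (x : Fin N → ℝ) : |lineIntegral (Pi.single i 1) f x| ≤ M := by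
  have h := abs_setIntegral_line_le hf hM i x Set.univ
  rwa [setIntegral_univ] at h

theorem abs_primitive_le {M : ℝ} (hf : ∀ x ∉ cube N, f x = 0) (hM : ∀ x, |f x| ≤ M)
    (i : Fin N) (x : Fin N → ℝ) : |primitive (Pi.single i 1) f x| ≤ M :=
  abs_setIntegral_line_le hf hM i x _

protected theorem IsTestFun.redistribute (hf : IsTestFun (cube N) f)
    (hη : IsTestFun (Set.Ioo 0 1) η) (i : Fin N) :
    IsTestFun (cube N) (redistribute (Pi.single i 1) (ContinuousLinearMap.proj i) η f) := by
  have hcomp := hf.hasCompactSupport.isCompact.prod hη.hasCompactSupport.isCompact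
  refine of_support_subset (hf.contDiff_redistribute (single_one_ne_zero i) hη.contDiff)
    (hcomp.image (f := fun q => Function.update q.1 i q.2) (by fun_prop)) (fun x hx => ?_) ?_
  · obtain ⟨hline, hprofile⟩ := mul_ne_zero_iff.1 (Function.mem_support.1 hx)
    obtain ⟨t, ht⟩ := exists_ne_zero_of_integral_ne_zero hline
    refine ⟨(x + t • Pi.single i 1, x i), ⟨subset_tsupport f ht, subset_tsupport η hprofile⟩, ?_⟩
    ext j
    rcases eq_or_ne j i with rfl | hj <;> simp [*]
  · rintro _ ⟨⟨y, s⟩, ⟨hy, hs⟩, rfl⟩ j -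
    rcases eq_or_ne j i with rfl | hj
    · simpa using hη.tsupport_subset hs
    · simpa [hj] using hf.tsupport_subset hy j trivial

theorem abs_redistribute_le {M B : ℝ} (hf : ∀ x ∉ cube N, f x = 0) (hM : ∀ x, |f x| ≤ M)
    (hB : ∀ t, |η t| ≤ B) (i : Fin N) (ℓ : (Fin N → ℝ) →L[ℝ] ℝ) (x : Fin N → ℝ) :
    |redistribute (Pi.single i 1) ℓ η f x| ≤ M * B := by
  rw [redistribute, abs_mul]
  exact mul_le_mul (abs_lineIntegral_le hf hM i x) (hB _) (abs_nonneg _)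
    ((abs_nonneg _).trans (hM 0))

theorem exists_isTestFun_integral_eq_one :
    ∃ η : ℝ → ℝ, IsTestFun (Set.Ioo 0 1) η ∧ ∫ t, η t = 1 := by
  let b : ContDiffBump (1 / 2 : ℝ) := ⟨1 / 8, 1 / 4, by norm_num, by norm_num⟩
  refine ⟨b.normed volume, ⟨b.contDiff_normed, b.hasCompactSupport_normed, ?_⟩,
    b.integral_normed⟩
  rw [b.tsupport_normed_eq, Real.closedBall_eq_Icc]
  exact Set.Icc_subset_Ioo (by norm_num [b]) (by norm_num [b])

theorem IsTestFun.exists_eq_dirDeriv_add_redistribute (hf : IsTestFun (cube N) f)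
    (hη : IsTestFun (Set.Ioo 0 1) η) (hη1 : ∫ t, η t = 1) {M B : ℝ} (hM : ∀ x, |f x| ≤ M)
    (hB : ∀ t, |η t| ≤ B) (i : Fin N) :
    ∃ g, IsTestFun (cube N) g ∧ (∀ x, |g x| ≤ M + M * B) ∧
      f = dirDeriv (Pi.single i 1) g +
        redistribute (Pi.single i 1) (ContinuousLinearMap.proj i) η f := by
  have hv := single_one_ne_zero i
  have hred := hf.redistribute hη i
  have hh := hf.sub hred
  have h0 : lineIntegral (Pi.single i 1) (f - redistribute (Pi.single i 1)
      (ContinuousLinearMap.proj i) η f) = 0 := by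
    rw [lineIntegral_sub hf hred hv, lineIntegral_redistribute (by simp), hη1, one_smul, sub_self]
  refine ⟨_, hh.primitive convex_cube hv h0, ?_, ?_⟩
  · refine abs_primitive_le (fun x hx => hh.eq_zero hx) (fun x => ?_) i
    exact (abs_sub _ _).trans
      (add_le_add (hM x) (abs_redistribute_le (fun x hx => hf.eq_zero hx) hM hB i _ x))
  · rw [hh.dirDeriv_primitive hv, sub_add_cancel]

theorem IsTestFun.exists_iterate_dirDeriv_eq_succ_add {g : (Fin N → ℝ) → ℝ} {M B B' : ℝ} {k : ℕ}
    (hg : IsTestFun (cube N) g) (hη : IsTestFun (Set.Ioo 0 1) η) (hη1 : ∫ t, η t = 1)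
    (hM : ∀ x, |g x| ≤ M) (hB : ∀ t, |η t| ≤ B) (hB' : ∀ t, |(dirDeriv 1)^[k + 1] η t| ≤ B')
    (i : Fin N) :
    ∃ h T, IsTestFun (cube N) h ∧ IsTestFun (cube N) T ∧ (∀ x, |h x| ≤ M + M * B) ∧
      (∀ x, |dirDeriv (Pi.single i 1) T x| ≤ M * B') ∧
      (dirDeriv (Pi.single i 1))^[k] g = (dirDeriv (Pi.single i 1))^[k + 1] h + T := by
  obtain ⟨h, hh, hhM, hgh⟩ := hg.exists_eq_dirDeriv_add_redistribute hη hη1 hM hB i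
  have hηk := hη.iterate_dirDeriv 1 k
  have hℓ : ContinuousLinearMap.proj (R := ℝ) (φ := fun _ : Fin N => ℝ) i (Pi.single i 1) = 1 := by
    simp
  refine ⟨h, _, hh, hg.redistribute hηk i, hhM, fun x => ?_, ?_⟩
  · rw [hg.dirDeriv_redistribute hℓ hηk.contDiff,
      ← Function.iterate_succ_apply' (dirDeriv (1 : ℝ))]
    exact abs_redistribute_le (fun x hx => hg.eq_zero hx) hM hB' i _ x
  · rw [← hg.iterate_dirDeriv_redistribute hℓ hη, Function.iterate_succ_apply,
      ← iterate_dirDeriv_add (hh.dirDeriv _) (hg.redistribute hη i), ← hgh]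

theorem exists_eq_iterate_dirDeriv_add (N k : ℕ) :
    ∃ C, 0 < C ∧ ∀ (i : Fin N) (f : (Fin N → ℝ) → ℝ), IsTestFun (cube N) f → (∀ x, |f x| ≤ 1) →
      ∃ g R, IsTestFun (cube N) g ∧ IsTestFun (cube N) R ∧ (∀ x, |g x| ≤ C) ∧
        (∀ x, |dirDeriv (Pi.single i 1) R x| ≤ C) ∧
        f = (dirDeriv (Pi.single i 1))^[k] g + R := by
  induction k with
  | zero =>
    refine ⟨1, one_pos, fun i f hf hf1 => ⟨f, 0, hf, .zero, hf1, fun x => ?_, ?_⟩⟩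
    · simp [dirDeriv]
    · simp
  | succ k ih =>
    obtain ⟨C, hC, hsplit⟩ := ih
    obtain ⟨η, hη, hη1⟩ := exists_isTestFun_integral_eq_one
    obtain ⟨B, hB0, hB⟩ := hη.exists_bound
    obtain ⟨B', hB'0, hB'⟩ := (hη.iterate_dirDeriv 1 (k + 1)).exists_bound
    have hCB : 0 ≤ C * B := by positivity
    have hCB' : 0 ≤ C * B' := by positivity
    refine ⟨C + C * B + C * B', by positivity, fun i f hf hf1 => ?_⟩
    obtain ⟨g, R, hg, hR, hgC, hRC, hfgR⟩ := hsplit i f hf hf1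
    obtain ⟨h, T, hh, hT, hhC, hTC, hghT⟩ :=
      hg.exists_iterate_dirDeriv_eq_succ_add hη hη1 hgC hB hB' i
    refine ⟨h, T + R, hh, hT.add hR, fun x => by linarith [hhC x], fun x => ?_, ?_⟩
    · rw [dirDeriv_add hT.differentiable hR.differentiable, Pi.add_apply]
      exact (abs_add_le _ _).trans (by linarith [hTC x, hRC x])
    · rw [hfgR, hghT, add_assoc]

end Cube

section FractionalIntegral

variable {E : Type*} [NormedAddCommGroup E] [NormedSpace ℝ E] {f g : E → ℝ} {v : E}
  {s : ℝ}

/-- The right-sided Riemann-Liouville integral of order `1 - s` in the direction `v`. The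
integration over `[0, 1]` is over the whole ray when `f` vanishes beyond that segment. -/
noncomputable def fracIntegral (s : ℝ) (v : E) (f : E → ℝ) (x : E) : ℝ :=
  1 / Real.Gamma (1 - s) * ∫ τ in (0 : ℝ)..1, f (x + τ • v) / τ ^ s

theorem intervalIntegrable_div_rpow (hs : s < 1) {w : ℝ → ℝ} (hw : Continuous w) {b : ℝ}
    (hb : 0 ≤ b) : IntervalIntegrable (fun τ => w τ / τ ^ s) volume 0 b := by
  have h := (intervalIntegral.intervalIntegrable_rpow' (a := 0) (b := b) (r := -s)
    (by linarith)).continuousOn_mul hw.continuousOn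
  refine h.congr fun τ hτ => ?_
  rw [Set.uIoc_of_le hb] at hτ
  simp only [Real.rpow_neg hτ.1.le, div_eq_mul_inv]

theorem intervalIntegrable_line_div_rpow (hs : s < 1) (hf : Continuous f) (x v : E) :
    IntervalIntegrable (fun τ : ℝ => f (x + τ • v) / τ ^ s) volume 0 1 :=
  intervalIntegrable_div_rpow hs (hf.comp (by fun_prop)) zero_le_one

theorem norm_div_rpow_le {a M τ : ℝ} (ha : |a| ≤ M) (hτ : τ ∈ Set.uIoc 0 1) :
    ‖a / τ ^ s‖ ≤ M / τ ^ s := by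
  rw [Set.uIoc_of_le zero_le_one] at hτ
  have hpow := Real.rpow_nonneg hτ.1.le s
  rw [Real.norm_eq_abs, abs_div, abs_of_nonneg hpow]
  exact div_le_div_of_nonneg_right ha hpow

theorem integral_const_div_rpow (hs : s < 1) (M : ℝ) :
    ∫ τ in (0 : ℝ)..1, M / τ ^ s = M / (1 - s) := by
  have hpow : ∫ τ in (0 : ℝ)..1, τ ^ (-s) = 1 / (1 - s) := by
    rw [integral_rpow (.inl (by linarith)), Real.one_rpow, Real.zero_rpow (by linarith), sub_zero,
      neg_add_eq_sub]
  rw [← mul_one_div M (1 - s), ← hpow, ← intervalIntegral.integral_const_mul]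
  refine intervalIntegral.integral_congr fun τ hτ => ?_
  rw [Set.uIcc_of_le zero_le_one] at hτ
  simp only [Real.rpow_neg hτ.1, div_eq_mul_inv]

theorem fracIntegral_add (hs : s < 1) (hf : Continuous f) (hg : Continuous g) (v : E) :
    fracIntegral s v (f + g) = fracIntegral s v f + fracIntegral s v g := by
  ext x
  simp only [fracIntegral, Pi.add_apply, add_div]
  rw [intervalIntegral.integral_add (intervalIntegrable_line_div_rpow hs hf x v)
    (intervalIntegrable_line_div_rpow hs hg x v), mul_add]

theorem abs_fracIntegral_le (hs : s < 1) {M : ℝ} (hM : ∀ x, |f x| ≤ M) (v x : E) :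
    |fracIntegral s v f x| ≤ M / Real.Gamma (2 - s) := by
  have hs' : 0 < 1 - s := sub_pos.2 hs
  have hΓ : 0 < Real.Gamma (1 - s) := Real.Gamma_pos_of_pos hs'
  have hint : |∫ τ in (0 : ℝ)..1, f (x + τ • v) / τ ^ s| ≤ M / (1 - s) := by
    rw [← integral_const_div_rpow hs, ← Real.norm_eq_abs]
    refine intervalIntegral.norm_integral_le_of_norm_le zero_le_one (.of_forall fun τ hτ => ?_)
      (intervalIntegrable_div_rpow hs continuous_const zero_le_one)
    exact norm_div_rpow_le (hM _) (by rwa [Set.uIoc_of_le zero_le_one])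
  calc |fracIntegral s v f x|
      = 1 / Real.Gamma (1 - s) * |∫ τ in (0 : ℝ)..1, f (x + τ • v) / τ ^ s| := by
        rw [fracIntegral, abs_mul, abs_of_pos (one_div_pos.2 hΓ)]
    _ ≤ 1 / Real.Gamma (1 - s) * (M / (1 - s)) := by gcongr
    _ = M / Real.Gamma (2 - s) := by
        rw [show 2 - s = 1 - s + 1 by ring, Real.Gamma_add_one hs'.ne']
        field_simp

theorem continuous_fracIntegral (hs : s < 1) (hf : Continuous f) {M : ℝ} (hM : ∀ x, |f x| ≤ M)
    (v : E) : Continuous (fracIntegral s v f) := by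
  refine continuous_const.mul (intervalIntegral.continuous_of_dominated_interval
    (bound := fun τ => M / τ ^ s) (fun x => ?_)
    (fun x => .of_forall fun τ hτ => norm_div_rpow_le (hM _) hτ)
    (intervalIntegrable_div_rpow hs continuous_const zero_le_one) (.of_forall fun τ _ => ?_))
  · exact (intervalIntegrable_iff.1
      (intervalIntegrable_line_div_rpow hs hf x v)).aestronglyMeasurable
  · have hshift : Continuous fun x => f (x + τ • v) :=
      hf.comp (continuous_id.add continuous_const)
    exact hshift.div_const _

theorem fracIntegral_comp_line (s : ℝ) (v : E) (f : E → ℝ) (x : E) (y : ℝ) :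
    fracIntegral s 1 (fun t : ℝ => f (x + t • v)) y = fracIntegral s v f (x + y • v) := by
  simp only [fracIntegral, add_smul, smul_eq_mul, mul_one, add_assoc]

theorem hasDerivAt_fracIntegral_line (hs : s < 1) (hf : Differentiable ℝ f)
    (hf' : Continuous (dirDeriv v f)) {M : ℝ} (hM : ∀ x, |dirDeriv v f x| ≤ M) (x : E) (y : ℝ) :
    HasDerivAt (fun y : ℝ => fracIntegral s v f (x + y • v))
      (fracIntegral s v (dirDeriv v f) (x + y • v)) y := by
  refine HasDerivAt.const_mul _ ?_
  refine (intervalIntegral.hasDerivAt_integral_of_dominated_loc_of_deriv_le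
    (F := fun y τ => f (x + y • v + τ • v) / τ ^ s)
    (F' := fun y τ => dirDeriv v f (x + y • v + τ • v) / τ ^ s)
    (bound := fun τ => M / τ ^ s) univ_mem (.of_forall fun z => ?_)
    (intervalIntegrable_line_div_rpow hs hf.continuous _ v) ?_
    (.of_forall fun τ hτ z _ => norm_div_rpow_le (hM _) hτ)
    (intervalIntegrable_div_rpow hs continuous_const zero_le_one)
    (.of_forall fun τ _ z _ => ?_)).2
  · exact (intervalIntegrable_iff.1
      (intervalIntegrable_line_div_rpow hs hf.continuous _ v)).aestronglyMeasurable
  · exact (intervalIntegrable_iff.1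
      (intervalIntegrable_line_div_rpow hs hf' _ v)).aestronglyMeasurable
  · simp only [add_right_comm x _ (τ • v)]
    exact (hasDerivAt_comp_line hf (x + τ • v) v z).div_const _

theorem integral_div_sub_rpow_eq (hs : s < 1) {w : ℝ → ℝ} (hw : Continuous w)
    (h1 : ∀ t, 1 ≤ t → w t = 0) {y : ℝ} (hy : y ∈ Set.Icc (0 : ℝ) 1) :
    ∫ t in y..1, w t / (t - y) ^ s = ∫ τ in (0 : ℝ)..1, w (y + τ) / τ ^ s := by
  have hint : ∀ b, 0 ≤ b → IntervalIntegrable (fun τ => w (y + τ) / τ ^ s) volume 0 b :=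
    fun b => intervalIntegrable_div_rpow hs (hw.comp (by fun_prop))
  have hb := hint (1 - y) (by linarith [hy.2])
  have hzero : ∫ τ in (1 - y)..1, w (y + τ) / τ ^ s = 0 := by
    refine intervalIntegral.integral_zero_ae (.of_forall fun τ hτ => ?_)
    rw [Set.uIoc_of_le (by linarith [hy.1])] at hτ
    rw [h1 _ (by linarith [hτ.1]), zero_div]
  have hshift := intervalIntegral.integral_comp_add_left (a := 0) (b := 1 - y)
    (fun t => w t / (t - y) ^ s) y
  simp only [add_sub_cancel_left, add_zero, add_sub_cancel] at hshift
  rw [← hshift, ← intervalIntegral.integral_add_adjacent_intervals hb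
    (hb.symm.trans (hint 1 zero_le_one)), hzero, add_zero]

theorem rightRL_eq_neg_deriv_fracIntegral (hs : s < 1) {w : ℝ → ℝ} (hw : Continuous w)
    (h1 : ∀ t, 1 ≤ t → w t = 0) {y : ℝ} (hy : y ∈ Set.Ioo (0 : ℝ) 1) :
    rightRL s w y = -deriv (fracIntegral s 1 w) y := by
  have hnear : (fun y => ∫ t in y..1, w t / (t - y) ^ s) =ᶠ[𝓝 y]
      fun y => ∫ τ in (0 : ℝ)..1, w (y + τ • 1) / τ ^ s := by
    filter_upwards [isOpen_Ioo.mem_nhds hy] with z hz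
    simpa using integral_div_sub_rpow_eq hs hw h1 (Set.Ioo_subset_Icc_self hz)
  have hderiv : deriv (fracIntegral s 1 w) y = 1 / Real.Gamma (1 - s) *
      deriv (fun y => ∫ τ in (0 : ℝ)..1, w (y + τ • 1) / τ ^ s) y := deriv_const_mul_field _
  rw [rightRL, hnear.deriv_eq, hderiv, neg_mul]

end FractionalIntegral

section FractionalDivergence

variable {N : ℕ} {s : ℝ} {F G : Fin N → (Fin N → ℝ) → ℝ}

theorem IsTestFun.partialRL_eq {f : (Fin N → ℝ) → ℝ} (hf : IsTestFun (cube N) f) (hs : s < 1)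
    (i : Fin N) {x : Fin N → ℝ} (hx : x ∈ cube N) :
    partialRL s i f x =
      -fracIntegral s (Pi.single i 1) (dirDeriv (Pi.single i 1) f) x := by
  have hf' := hf.dirDeriv (Pi.single i 1)
  obtain ⟨M, -, hM⟩ := hf'.exists_bound
  set x₀ : Fin N → ℝ := Function.update x i 0
  have hline : ∀ t : ℝ, Function.update x i t = x₀ + t • Pi.single i 1 := by
    intro t
    ext j
    rcases eq_or_ne j i with rfl | hj <;> simp [x₀, *]
  have hxi : x₀ + x i • Pi.single i 1 = x := by rw [← hline, Function.update_eq_self]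
  have hvanish : ∀ t : ℝ, 1 ≤ t → f (x₀ + t • Pi.single i 1) = 0 := by
    refine fun t ht => hf.eq_zero fun hmem => ht.not_gt ?_
    simpa [x₀] using (hmem i trivial).2
  rw [partialRL]
  simp only [hline]
  rw [rightRL_eq_neg_deriv_fracIntegral hs
    (hf.comp_line (single_one_ne_zero i) x₀).continuous hvanish (hx i trivial)]
  simp only [funext (fracIntegral_comp_line s (Pi.single i 1) f x₀)]
  rw [(hasDerivAt_fracIntegral_line hs hf.differentiable hf'.continuous hM x₀ (x i)).deriv, hxi]

theorem fracDiv_eq (hs : s < 1) (hF : ∀ i, IsTestFun (cube N) (F i)) {x : Fin N → ℝ}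
    (hx : x ∈ cube N) :
    fracDiv s F x = -((1 - 1 / (N : ℝ)) * s + 1 / (N : ℝ)) *
      ∑ i, fracIntegral s (Pi.single i 1) (dirDeriv (Pi.single i 1) (F i)) x := by
  simp only [fracDiv, fun i => (hF i).partialRL_eq hs i hx, Finset.sum_neg_distrib, mul_neg,
    neg_mul]

theorem fracDiv_add (hs : s < 1) (hF : ∀ i, IsTestFun (cube N) (F i))
    (hG : ∀ i, IsTestFun (cube N) (G i)) {x : Fin N → ℝ} (hx : x ∈ cube N) :
    fracDiv s (F + G) x = fracDiv s F x + fracDiv s G x := by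
  have hsum : ∀ i, fracIntegral s (Pi.single i 1) (dirDeriv (Pi.single i 1) ((F + G) i)) x =
      fracIntegral s (Pi.single i 1) (dirDeriv (Pi.single i 1) (F i)) x +
        fracIntegral s (Pi.single i 1) (dirDeriv (Pi.single i 1) (G i)) x := by
    intro i
    rw [Pi.add_apply, dirDeriv_add (hF i).differentiable (hG i).differentiable,
      fracIntegral_add hs ((hF i).dirDeriv _).continuous ((hG i).dirDeriv _).continuous,
      Pi.add_apply]
  rw [fracDiv_eq (F := F + G) hs (fun i => (hF i).add (hG i)) hx, fracDiv_eq hs hF hx,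
    fracDiv_eq hs hG hx]
  simp only [hsum, Finset.sum_add_distrib, mul_add]

theorem fracDiv_const_smul (s c : ℝ) (F : Fin N → (Fin N → ℝ) → ℝ) :
    fracDiv s (c • F) = c • fracDiv s F := by
  ext x
  simp only [fracDiv, partialRL, rightRL, Pi.smul_apply, smul_eq_mul, mul_div_assoc,
    intervalIntegral.integral_const_mul, deriv_const_mul_field, Finset.mul_sum]
  refine Finset.sum_congr rfl fun i _ => ?_
  ring

theorem exists_abs_fracDiv_le (N : ℕ) (hs : s < 1) :
    ∃ K, ∀ (F : Fin N → (Fin N → ℝ) → ℝ) (M : ℝ), (∀ i, IsTestFun (cube N) (F i)) →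
      (∀ i x, |dirDeriv (Pi.single i 1) (F i) x| ≤ M) → ∀ x ∈ cube N, |fracDiv s F x| ≤ K * M := by
  set κ : ℝ := -((1 - 1 / (N : ℝ)) * s + 1 / (N : ℝ)) with hκ
  refine ⟨|κ| * (N / Real.Gamma (2 - s)), fun F M hF hM x hx => ?_⟩
  rw [fracDiv_eq hs hF hx, ← hκ, abs_mul, mul_assoc]
  refine mul_le_mul_of_nonneg_left ?_ (abs_nonneg κ)
  calc |∑ i, fracIntegral s (Pi.single i 1) (dirDeriv (Pi.single i 1) (F i)) x|
      ≤ ∑ i, |fracIntegral s (Pi.single i 1) (dirDeriv (Pi.single i 1) (F i)) x| :=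
        Finset.abs_sum_le_sum_abs _ _
    _ ≤ ∑ _i : Fin N, M / Real.Gamma (2 - s) :=
        Finset.sum_le_sum fun i _ => abs_fracIntegral_le hs (hM i) _ x
    _ = N / Real.Gamma (2 - s) * M := by
        rw [Finset.sum_const, Finset.card_univ, Fintype.card_fin, nsmul_eq_mul]
        ring

theorem continuousOn_fracDiv (hs : s < 1) (hF : ∀ i, IsTestFun (cube N) (F i)) :
    ContinuousOn (fracDiv s F) (cube N) := by
  have hcont : ∀ i, Continuous
      (fracIntegral s (Pi.single i 1) (dirDeriv (Pi.single i 1) (F i))) := fun i => by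
    obtain ⟨M, -, hM⟩ := ((hF i).dirDeriv (Pi.single i 1)).exists_bound
    exact continuous_fracIntegral hs ((hF i).dirDeriv _).continuous hM _
  exact (continuous_const.mul (continuous_finsetSum _ fun i _ => hcont i)).continuousOn.congr
    fun x hx => fracDiv_eq hs hF hx

theorem integrableOn_mul_fracDiv (hs : s < 1) (hF : ∀ i, IsTestFun (cube N) (F i))
    {u : (Fin N → ℝ) → ℝ} (hu : IntegrableOn u (cube N)) :
    IntegrableOn (fun x => u x * fracDiv s F x) (cube N) := by
  choose M hM0 hM using fun i => ((hF i).dirDeriv (Pi.single i 1)).exists_bound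
  obtain ⟨K, hK⟩ := exists_abs_fracDiv_le N hs
  have hbound := hK F (∑ i, M i) hF fun i x =>
    (hM i x).trans (Finset.single_le_sum (fun j _ => hM0 j) (Finset.mem_univ i))
  exact hu.mul_bdd ((continuousOn_fracDiv hs hF).aestronglyMeasurable measurableSet_cube)
    (ae_restrict_of_forall_mem measurableSet_cube hbound)

end FractionalDivergence

section DualNorm

variable {ι : Type} [Fintype ι] {p : ℝ≥0∞}

theorem sum_mul_le_sum_abs [Fact (1 ≤ p)] (a : ι → ℝ) {y : PiLp p fun _ : ι => ℝ}
    (hy : ‖y‖ ≤ 1) : ∑ i, a i * y i ≤ ∑ i, |a i| := by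
  refine Finset.sum_le_sum fun i _ => ?_
  have hyi : |y i| ≤ 1 := (PiLp.norm_apply_le y i).trans hy
  calc a i * y i ≤ |a i| * |y i| := (le_abs_self _).trans (abs_mul _ _).le
    _ ≤ |a i| := mul_le_of_le_one_right (abs_nonneg _) hyi

theorem dualNorm_le_sum_abs (hp : 1 ≤ p) (a : ι → ℝ) : dualNorm p a ≤ ∑ i, |a i| := by
  have : Fact (1 ≤ p) := ⟨hp⟩
  refine csSup_le ⟨0, 0, by simp, by simp⟩ ?_
  rintro _ ⟨y, hy, rfl⟩
  exact sum_mul_le_sum_abs a hy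

theorem abs_le_dualNorm (hp : 1 ≤ p) (a : ι → ℝ) (i : ι) : |a i| ≤ dualNorm p a := by
  classical
  have : Fact (1 ≤ p) := ⟨hp⟩
  have hσ : |(SignType.sign (a i) : ℝ)| ≤ 1 := by
    rcases lt_trichotomy (a i) 0 with h | h | h <;> simp [h]
  refine le_csSup ⟨∑ i, |a i|, ?_⟩ ⟨PiLp.single p i (SignType.sign (a i) : ℝ), ?_, ?_⟩
  · rintro _ ⟨y, hy, rfl⟩
    exact sum_mul_le_sum_abs a hy
  · rwa [PiLp.norm_single, Real.norm_eq_abs]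
  · simp [mul_comm (a _), sign_mul_self]

end DualNorm

section TotalVariation

variable {N k : ℕ} {s : ℝ} {p : ℝ≥0∞}

section Test

variable {ι : Type} [Fintype ι] {φ : ι → (Fin N → ℝ) → ℝ}

theorem IsTest.isTestFun (h : IsTest p φ) (i : ι) : IsTestFun (cube N) (φ i) :=
  ⟨(h.1 i).1, (h.1 i).2.1, (h.1 i).2.2⟩

theorem IsTest.abs_le_one (h : IsTest p φ) (hp : 1 ≤ p) (i : ι) (x : Fin N → ℝ) : |φ i x| ≤ 1 :=
  (abs_le_dualNorm hp (fun i => φ i x) i).trans (h.2 x)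

theorem isTest_of_sum_abs_le_one (hp : 1 ≤ p) (hφ : ∀ i, IsTestFun (cube N) (φ i))
    (hsum : ∀ x, ∑ i, |φ i x| ≤ 1) : IsTest p φ :=
  ⟨fun i => ⟨(hφ i).contDiff, (hφ i).hasCompactSupport, (hφ i).tsupport_subset⟩,
    fun x => (dualNorm_le_sum_abs hp _).trans (hsum x)⟩

end Test

theorem iterDiv_const_smul (k : ℕ) (c : ℝ) (φ : (Fin k → Fin N) → (Fin N → ℝ) → ℝ) :
    iterDiv k (c • φ) = c • iterDiv k φ := by
  induction k with
  | zero => rfl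
  | succ k ih =>
    rw [iterDiv, iterDiv, ← ih]
    congr 1
    ext a x
    simp only [Pi.smul_apply, fderiv_const_smul_field, smul_apply, Finset.smul_sum]

theorem ofReal_integral_mul_fracDiv_le (hp : 1 ≤ p)
    {φ : Fin N × (Fin k → Fin N) → (Fin N → ℝ) → ℝ} (hφ : ∀ q, IsTestFun (cube N) (φ q)) {L : ℝ}
    (hL : 0 < L) (hφL : ∀ x, ∑ q, |φ q x| ≤ L) (s : ℝ) (u : (Fin N → ℝ) → ℝ) :
    ENNReal.ofReal (∫ x in cube N, u x * fracDiv s (fun i => iterDiv k fun a => φ (i, a)) x) ≤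
      ENNReal.ofReal L * fracTV p k s u := by
  have htest : IsTest p (L⁻¹ • φ) := by
    refine isTest_of_sum_abs_le_one hp (fun q => (hφ q).const_smul L⁻¹) fun x => ?_
    calc ∑ q, |(L⁻¹ • φ) q x| = L⁻¹ * ∑ q, |φ q x| := by
          simp only [Pi.smul_apply, smul_eq_mul, abs_mul, abs_of_pos (inv_pos.2 hL),
            Finset.mul_sum]
      _ ≤ 1 := (inv_mul_le_one₀ hL).2 (hφL x)
  have hscale : fracDiv s (fun i => iterDiv k fun a => (L⁻¹ • φ) (i, a)) =
      L⁻¹ • fracDiv s fun i => iterDiv k fun a => φ (i, a) := by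
    rw [← fracDiv_const_smul]
    exact congrArg _ (funext fun i => iterDiv_const_smul k L⁻¹ fun a => φ (i, a))
  calc ENNReal.ofReal (∫ x in cube N, u x * fracDiv s (fun i => iterDiv k fun a => φ (i, a)) x)
      = ENNReal.ofReal L * ENNReal.ofReal
          (∫ x in cube N, u x * fracDiv s (fun i => iterDiv k fun a => (L⁻¹ • φ) (i, a)) x) := by
        rw [← ENNReal.ofReal_mul hL.le, ← integral_const_mul]
        congr 2 with x
        rw [hscale, Pi.smul_apply, smul_eq_mul]
        field_simp
    _ ≤ ENNReal.ofReal L * fracTV p k s u := by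
        gcongr
        exact le_iSup₂ (f := fun (φ : Fin N × (Fin k → Fin N) → (Fin N → ℝ) → ℝ)
          (_ : IsTest p φ) => ENNReal.ofReal
            (∫ x in cube N, u x * fracDiv s (fun i => iterDiv k fun a => φ (i, a)) x)) _ htest

/-- The field of `N × N^k` arrays whose only entries are the functions `g i`, at the positions
`(i, i … i)`. -/
def diagField (k : ℕ) (g : Fin N → (Fin N → ℝ) → ℝ) (q : Fin N × (Fin k → Fin N)) :
    (Fin N → ℝ) → ℝ :=
  if q.2 = fun _ => q.1 then g q.1 else 0

theorem snoc_eq_const_iff {α : Type*} {i j : α} {a : Fin k → α} :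
    (Fin.snoc (α := fun _ => α) a j = fun _ => i) ↔ (a = fun _ => i) ∧ j = i := by
  have hconst : (fun _ => i) = Fin.snoc (α := fun _ => α) (fun _ : Fin k => i) i := by
    ext l
    refine Fin.lastCases ?_ (fun m => ?_) l <;> simp
  rw [hconst, Fin.snoc_inj]

theorem iterDiv_ite_const (i : Fin N) (k : ℕ) (g : (Fin N → ℝ) → ℝ) :
    iterDiv k (fun a => if a = fun _ => i then g else 0) = (dirDeriv (Pi.single i 1))^[k] g := by
  induction k generalizing g with
  | zero => simp [iterDiv, eq_iff_true_of_subsingleton]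
  | succ k ih =>
    rw [iterDiv, Function.iterate_succ_apply, ← ih]
    congr 1
    ext a x
    by_cases ha : a = fun _ => i
    · rw [Finset.sum_eq_single i (fun j _ hj => by simp [snoc_eq_const_iff, hj]) (by simp)]
      simp [snoc_eq_const_iff, ha, dirDeriv]
    · simp [snoc_eq_const_iff, ha]

theorem sum_abs_diagField (k : ℕ) (g : Fin N → (Fin N → ℝ) → ℝ) (x : Fin N → ℝ) :
    ∑ q, |diagField k g q x| = ∑ i, |g i x| := by
  simp [Fintype.sum_prod_type, diagField, apply_ite abs, ite_apply]

theorem isTestFun_diagField {g : Fin N → (Fin N → ℝ) → ℝ} (hg : ∀ i, IsTestFun (cube N) (g i))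
    (k : ℕ) (q : Fin N × (Fin k → Fin N)) : IsTestFun (cube N) (diagField k g q) := by
  rw [diagField]
  split_ifs
  exacts [hg _, .zero]

theorem ofReal_setIntegral_mul_le {u w : (Fin N → ℝ) → ℝ} {M : ℝ}
    (hM : ∀ x ∈ cube N, |w x| ≤ M) :
    ENNReal.ofReal (∫ x in cube N, u x * w x) ≤ ENNReal.ofReal M * normL1 u := by
  calc ENNReal.ofReal (∫ x in cube N, u x * w x)
      ≤ ‖∫ x in cube N, u x * w x‖ₑ := Real.ofReal_le_enorm _
    _ ≤ ∫⁻ x in cube N, ‖u x * w x‖ₑ := enorm_integral_le_lintegral_enorm _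
    _ ≤ ∫⁻ x in cube N, ENNReal.ofReal M * ‖u x‖ₑ := by
        refine setLIntegral_mono' measurableSet_cube fun x hx => ?_
        rw [enorm_mul, mul_comm, Real.enorm_eq_ofReal_abs (w x)]
        gcongr
        exact hM x hx
    _ = ENNReal.ofReal M * normL1 u := lintegral_const_mul' _ _ ENNReal.ofReal_ne_top

theorem intTV_zero_le_normL1 (hp : 1 ≤ p) (u : (Fin N → ℝ) → ℝ) : intTV p 0 u ≤ normL1 u := by
  refine iSup₂_le fun φ hφ => ?_
  calc ENNReal.ofReal (∫ x in cube N, u x * iterDiv 0 φ x)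
      ≤ ENNReal.ofReal 1 * normL1 u :=
        ofReal_setIntegral_mul_le fun x _ => hφ.abs_le_one hp _ x
    _ = normL1 u := by rw [ENNReal.ofReal_one, one_mul]

theorem ofReal_integral_mul_fracDiv_iterate_add_le (hs : s < 1) (hp : 1 ≤ p)
    {u : (Fin N → ℝ) → ℝ} (hu : IntegrableOn u (cube N)) {g R : Fin N → (Fin N → ℝ) → ℝ}
    (hg : ∀ i, IsTestFun (cube N) (g i)) (hR : ∀ i, IsTestFun (cube N) (R i)) {L M : ℝ}
    (hL : 0 < L) (hgL : ∀ x, ∑ i, |g i x| ≤ L) (hRM : ∀ x ∈ cube N, |fracDiv s R x| ≤ M) :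
    ENNReal.ofReal (∫ x in cube N,
        u x * fracDiv s (fun i => (dirDeriv (Pi.single i 1))^[k] (g i) + R i) x) ≤
      ENNReal.ofReal L * fracTV p k s u + ENNReal.ofReal M * normL1 u := by
  set D : Fin N → (Fin N → ℝ) → ℝ := fun i => (dirDeriv (Pi.single i 1))^[k] (g i)
  have hD : ∀ i, IsTestFun (cube N) (D i) := fun i => (hg i).iterate_dirDeriv _ k
  have hdiag : (fun i => iterDiv k fun a => diagField k g (i, a)) = D :=
    funext fun i => iterDiv_ite_const i k (g i)
  have hsplit : ∫ x in cube N, u x * fracDiv s (D + R) x =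
      (∫ x in cube N, u x * fracDiv s D x) + ∫ x in cube N, u x * fracDiv s R x := by
    rw [← integral_add (integrableOn_mul_fracDiv hs hD hu) (integrableOn_mul_fracDiv hs hR hu)]
    refine setIntegral_congr_fun measurableSet_cube fun x hx => ?_
    simp only [fracDiv_add hs hD hR hx, mul_add]
  calc ENNReal.ofReal (∫ x in cube N, u x * fracDiv s (D + R) x)
      ≤ ENNReal.ofReal (∫ x in cube N, u x * fracDiv s D x) +
          ENNReal.ofReal (∫ x in cube N, u x * fracDiv s R x) := by
        rw [hsplit]
        exact ENNReal.ofReal_add_le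
    _ ≤ ENNReal.ofReal L * fracTV p k s u + ENNReal.ofReal M * normL1 u := by
        refine add_le_add ?_ (ofReal_setIntegral_mul_le hRM)
        rw [← hdiag]
        exact ofReal_integral_mul_fracDiv_le hp (isTestFun_diagField hg k) hL
          (fun x => (sum_abs_diagField k g x).trans_le (hgL x)) s u

theorem exists_fracTV_zero_le (N k : ℕ) (hs : s < 1) :
    ∃ C : ℝ, 0 < C ∧ ∀ p : ℝ≥0∞, 1 ≤ p → ∀ u : (Fin N → ℝ) → ℝ, IntegrableOn u (cube N) →
      fracTV p 0 s u ≤ ENNReal.ofReal C * (normL1 u + fracTV p k s u) := by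
  obtain ⟨C₀, hC₀, hsplit⟩ := exists_eq_iterate_dirDeriv_add N k
  obtain ⟨K, hK⟩ := exists_abs_fracDiv_le N hs
  have hL : 0 < (N + 1) * C₀ := by positivity
  refine ⟨max ((N + 1) * C₀) (K * C₀), lt_max_of_lt_left hL,
    fun p hp u hu => iSup₂_le fun φ hφ => ?_⟩
  choose g R hg hR hgC hRC hφgR using fun i =>
    hsplit i (φ (i, fun l => l.elim0)) (hφ.isTestFun _) (hφ.abs_le_one hp _)
  have hgL : ∀ x, ∑ i, |g i x| ≤ (N + 1) * C₀ := fun x =>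
    calc ∑ i, |g i x| ≤ ∑ _i : Fin N, C₀ := Finset.sum_le_sum fun i _ => hgC i x
      _ ≤ (N + 1) * C₀ := by simp [add_mul, hC₀.le]
  have hfield : (fun i => iterDiv 0 fun a => φ (i, a)) =
      fun i => (dirDeriv (Pi.single i 1))^[k] (g i) + R i := funext hφgR
  rw [hfield, mul_add, add_comm]
  refine (ofReal_integral_mul_fracDiv_iterate_add_le hs hp hu hg hR hL hgL
    (hK R C₀ hR hRC)).trans ?_
  gcongr
  exacts [le_max_left _ _, le_max_right _ _]

theorem integrableOn_of_mem_SV {r : ℝ} {u : (Fin N → ℝ) → ℝ} (hu : u ∈ SV N r) :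
    IntegrableOn u (cube N) :=
  let ⟨_, _, hv⟩ := hu 1 le_rfl
  hv.integrable_lim

end TotalVariation

end FracTV

theorem theorem4p7_general (N : ℕ) (r : NNReal) :
    ∃ C : ℝ, 0 < C ∧ ∀ p : ℝ≥0∞, 1 ≤ p → ∀ u : (Fin N → ℝ) → ℝ, IntegrableOn u (FracTV.cube N) →
      FracTV.TV p (Int.fract (r : ℝ)) u ≤
        ENNReal.ofReal C * (FracTV.normL1 u + FracTV.TV p r u) := by
  set s := Int.fract (r : ℝ) with hs
  have hfloor : ⌊s⌋₊ = 0 := Nat.floor_eq_zero.2 (Int.fract_lt_one _)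
  have hfract : Int.fract s = s := Int.fract_fract _
  by_cases hs0 : s = 0
  · refine ⟨1, one_pos, fun p hp u _ => ?_⟩
    calc FracTV.TV p s u = FracTV.intTV p 0 u := by rw [FracTV.TV, hfract, if_pos hs0, hfloor]
      _ ≤ FracTV.normL1 u := FracTV.intTV_zero_le_normL1 hp u
      _ ≤ ENNReal.ofReal 1 * (FracTV.normL1 u + FracTV.TV p r u) := by
          rw [ENNReal.ofReal_one, one_mul]
          exact le_self_add
  · obtain ⟨C, hC, hle⟩ := FracTV.exists_fracTV_zero_le N ⌊(r : ℝ)⌋₊ (Int.fract_lt_one (r : ℝ))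
    refine ⟨C, hC, fun p hp u hu => ?_⟩
    rw [FracTV.TV, FracTV.TV, hfract, ← hs, if_neg hs0, if_neg hs0, hfloor]
    exact hle p hp u hu

theorem theorem4p7 (N : ℕ) (hN : 1 ≤ N) (r : ℝ) (hr : 0 < r) :
    ∃ C : ℝ, 0 < C ∧ ∀ (p : ENNReal), 1 ≤ p → ∀ u : (Fin N → ℝ) → ℝ, u ∈ FracTV.SV N r →
      FracTV.TV p (Int.fract r) u ≤
        ENNReal.ofReal C * (FracTV.normL1 u + FracTV.TV p r u) := by
  obtain ⟨C, hC, hle⟩ := theorem4p7_general N ⟨r, hr.le⟩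
  exact ⟨C, hC, fun p hp u hu => hle p hp u (FracTV.integrableOn_of_mem_SV hu)⟩
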